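/- Consider the following infinitely repeated game of incomplete information with two players $i\in\{1,2\}$. The state $\theta\in\{H,L\}$ is drawn once and for all, with prior probability $p_0\in(0,1)$ of $\theta=H$. In every period $t=1,2,\dots$ each player $i$ observes a private signal $x_{it}$ in a finite set $X$ and then chooses an action $a_{it}\in\{I,N\}$; action profiles are observed by both players. Conditional on the state $\theta$, all signals are independent across players and across time with distribution $f_\theta\in\Delta(X)$, where $f_H\neq f_L$ and $f_\theta(x)>0$ for all $\theta\in\{H,L\}$ and $x\in X$. Player $i$'s private history when he chooses $a_{it}$ is $(a^{t-1},x_i^t)$, where $a^{t-1}=(a_1,\dots,a_{t-1})$ are the past action profiles and $x_i^t=(x_{i1},\dots,x_{it})$ his own signals. A pure strategy of player $i$ assigns an action to every private history; a (mixed) strategy is a Borel probability measure on the set of pure strategies, with the product topology. Let $\sigma=(\sigma_1,\sigma_2)$ be any strategy profile, and let $\mathbb{P}$ be the probability measure that it induces on the outcome space $\Omega=\{H,L\}\times(X^2)^{\infty}\times A^{\infty}$, $A=\{I,N\}^2$, when the two players draw their pure strategies independently of each other and of the state and the signals. For an event $F\subseteq\Omega$, $q\in(0,1)$ and a period $t$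 let $$B^q_{it}(F)=\{\omega\in\Omega:\mathbb{P}(F\mid a^{t-1},x_i^t)\ge q\},\qquad B^q_t(F)=B^q_{1t}(F)\cap B^q_{2t}(F),\qquad C^q_t(F)=\bigcap_{n\ge1}[B^q_t]^n(F),$$ where $[B^q_t]^n$ is the $n$-fold iterate of $B^q_t$, and where the conditional probability given a private history of probability zero is taken to be $0$. Then, under $\mathbb{P}$, the players commonly learn each state $\theta\in\{H,L\}$: for every $q\in(0,1)$ there is a $T$ such that for all $t\ge T$ $$\mathbb{P}\bigl[C^q_t(\theta)\mid\theta\bigr]>q,$$ where $C^q_t(\theta)$ is $C^q_t$ of the event that the state is $\theta$. -/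

import Mathlib

open MeasureTheory ProbabilityTheory

noncomputable section

namespace InvestmentGame

/-- The states of nature: high or low. -/
inductive State
  | H
  | L

instance : MeasurableSpace State := ⊤
instance : DiscreteMeasurableSpace State := ⟨fun _ => trivial⟩

/-- The stage actions: `I` (invest) and `N` (not invest), with the discrete topology. -/
inductive Action
  | I
  | N

instance : Finite Action :=
  Finite.of_surjective (fun b : Bool => if b then Action.I else Action.N) fun a => by
    cases a
    · exact ⟨true, rfl⟩
    · exact ⟨false, rfl⟩
instance : TopologicalSpace Action := ⊥
instance : DiscreteTopology Action := ⟨rfl⟩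
instance : MeasurableSpace Action := ⊤
instance : DiscreteMeasurableSpace Action := ⟨fun _ => trivial⟩
instance : BorelSpace Action := ⟨borel_eq_top_of_discrete.symm⟩

/-- Private histories of a player at the time of his decision in period `t`, where periods are
numbered from `0`: the `t` past action profiles, and his own `t + 1` signals so far. -/
abbrev PrivateHistory (X : Type*) (t : ℕ) : Type _ :=
  (Fin t → Fin 2 → Action) × (Fin (t + 1) → X)

/-- Pure strategies: an action for every private history of every period; the topology and the
σ-algebra are those of the product. -/
abbrev PureStrategy (X : Type*) : Type _ := (Σ t : ℕ, PrivateHistory X t) → Action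

/-- The product σ-algebra on pure strategies is the Borel σ-algebra of the product topology. -/
theorem borelSpace_pureStrategy (X : Type*) [Finite X] : BorelSpace (PureStrategy X) :=
  inferInstance

/-- Mixed strategies: Borel probability measures on the pure strategies. -/
abbrev MixedStrategy (X : Type*) : Type _ := ProbabilityMeasure (PureStrategy X)

/-- Outcomes of the repeated game: the state, the signals `x t i`, and the actions `a t i`,
of player `i` in period `t`. The σ-algebra is the product one, generated by the cylinders. -/
abbrev Outcome (X : Type*) : Type _ := State × (ℕ → Fin 2 → X) × (ℕ → Fin 2 → Action)

/-- The path of action profiles generated by the signals `x` under the pure strategies `s`. -/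
def play {X : Type*} (s : Fin 2 → PureStrategy X) (x : ℕ → Fin 2 → X) (t : ℕ) : Fin 2 → Action :=
  fun i => s i ⟨t, fun k => play s x k.val, fun k => x k.val i⟩
termination_by t
decreasing_by exact k.isLt

variable {X : Type*} [MeasurableSpace X]

/-- The law of all signals in state `θ`: independent across periods and across players, each with
distribution `f θ`. -/
def signalLaw (f : State → PMF X) (θ : State) : Measure (ℕ → Fin 2 → X) :=
  Measure.infinitePi fun _ : ℕ => Measure.pi fun _ : Fin 2 => (f θ).toMeasure

/-- The path of play is a measurable function of the signals and the pure strategies. -/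
theorem measurable_play [Finite X] [DiscreteMeasurableSpace X] :
    Measurable fun r : (ℕ → Fin 2 → X) × (Fin 2 → PureStrategy X) => play r.2 r.1 := by
  refine measurable_pi_lambda _ fun t => ?_
  induction t using Nat.strong_induction_on with
  | _ t ih =>
    refine measurable_pi_lambda _ fun i => ?_
    have hh : Measurable fun r : (ℕ → Fin 2 → X) × (Fin 2 → PureStrategy X) =>
        ((fun k => play r.2 r.1 k.val, fun k => r.1 k.val i) : PrivateHistory X t) := by
      refine Measurable.prodMk (measurable_pi_lambda _ fun k => ih k.val k.isLt)
        (measurable_pi_lambda _ fun k => ?_)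
      fun_prop
    have he : Measurable fun z : PrivateHistory X t × PureStrategy X => z.2 ⟨t, z.1⟩ :=
      measurable_from_prod_countable_right fun h =>
        measurable_pi_apply (⟨t, h⟩ : Σ t : ℕ, PrivateHistory X t)
    have hs : Measurable fun r : (ℕ → Fin 2 → X) × (Fin 2 → PureStrategy X) => r.2 i := by
      fun_prop
    have := he.comp (hh.prodMk hs)
    convert this using 2
    rw [play]
    rfl

/-- The law of the outcome in state `θ` under the mixed strategy profile `σ`: the players draw
their pure strategies independently of each other and of the signals, and then follow them. -/
def outcomeLaw (f : State → PMF X) (σ : Fin 2 → MixedStrategy X) (θ : State) :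
    Measure (Outcome X) :=
  Measure.map (fun r : (ℕ → Fin 2 → X) × (Fin 2 → PureStrategy X) => (θ, r.1, play r.2 r.1))
    ((signalLaw f θ).prod (Measure.pi fun i => (σ i : Measure (PureStrategy X))))

/-- The probability measure on outcomes induced by the profile `σ`, when the prior probability of
the high state is `p₀`. -/
def outcomeMeasure (p₀ : ℝ) (f : State → PMF X) (σ : Fin 2 → MixedStrategy X) :
    Measure (Outcome X) :=
  ENNReal.ofReal p₀ • outcomeLaw f σ State.H + ENNReal.ofReal (1 - p₀) • outcomeLaw f σ State.L

/-- The private history of player `i` in period `t` at the outcome `ω`. -/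
def privateHistory {X : Type*} (i : Fin 2) (t : ℕ) (ω : Outcome X) : PrivateHistory X t :=
  (fun k => ω.2.2 k.val, fun k => ω.2.1 k.val i)

/-- The probability that player `i` assigns to `F` in period `t` at `ω`, that is, the conditional
probability of `F` given his private history, of which there are finitely many (set to `0` at
histories of probability zero). -/
def belief (P : Measure (Outcome X)) (i : Fin 2) (t : ℕ) (F : Set (Outcome X)) (ω : Outcome X) :
    ℝ :=
  (cond P {ω' | privateHistory i t ω' = privateHistory i t ω}).real F

/-- The event that player `i` assigns probability at least `q` to `F` in period `t`. -/
def playerBelieves (P : Measure (Outcome X)) (q : ℝ) (i : Fin 2) (t : ℕ) (F : Set (Outcome X)) :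
    Set (Outcome X) :=
  {ω | q ≤ belief P i t F ω}

/-- The event that both players assign probability at least `q` to `F` in period `t`. -/
def bothBelieve (P : Measure (Outcome X)) (q : ℝ) (t : ℕ) (F : Set (Outcome X)) :
    Set (Outcome X) :=
  playerBelieves P q 0 t F ∩ playerBelieves P q 1 t F

/-- The event that `F` is common `q`-belief in period `t`. -/
def commonBelief (P : Measure (Outcome X)) (q : ℝ) (t : ℕ) (F : Set (Outcome X)) :
    Set (Outcome X) :=
  ⋂ n : ℕ, ⋂ _ : 1 ≤ n, (bothBelieve P q t)^[n] F

/-- The event that the state is `θ`. -/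
def stateEvent (X : Type*) (θ : State) : Set (Outcome X) := {ω | ω.1 = θ}

/-- Under `P`, the players commonly learn `θ`. -/
def CommonlyLearn (P : Measure (Outcome X)) (θ : State) : Prop :=
  ∀ q : ℝ, 0 < q → q < 1 → ∃ T : ℕ, ∀ t : ℕ, T ≤ t →
    q < (cond P (stateEvent X θ)).real (commonBelief P q t (stateEvent X θ))

end InvestmentGame

end

/-! Actions are public, and in a fixed state the pairs (signals, pure strategy) of the two players
are independent. A given path of actions occurs exactly when each pair meets a condition of its own,
so given the state and the public history the private histories are independent
(`condIndep_privateHistory`).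

Each player learns the state from the frequencies of his own signals, whatever the strategies
(`tendsto_not_playerBelieves`). For `r < 1`, consider the event that the state is `θ`, both players
believe `θ` with probability at least `r`, and the public history is one given which, in state `θ`,
each player does so with probability at least `r`. On it, a player gives `θ` probability at least
`r`; given `θ`, his private signals say nothing more about the other's belief than the public
history does, so he expects that belief with probability at least `r`. The event is thus `r *
r`-evident (`le_belief_evidentEvent`). By individual learning and Markov's inequality its
probability in state `θ` tends to one (`tendsto_evidentEvent`). An evident event inside `θ` makes
`θ` common belief (`subset_commonBelief`), so it remains to choose `r` with `q ≤ r * r`. -/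

noncomputable section

namespace InvestmentGame

variable {X : Type*} [MeasurableSpace X]

open Filter Topology

/-! ### Law of large numbers for signal frequencies. -/

section Frequencies

/-- The relative frequency of `x₀` among the first `t` entries of `y`. -/
def frequency (x₀ : X) (t : ℕ) (y : ℕ → X) : ℝ :=
  (∑ k ∈ Finset.range t, ({x₀} : Set X).indicator 1 (y k)) / t

variable [DiscreteMeasurableSpace X]

theorem measurable_frequency (x₀ : X) (t : ℕ) : Measurable (frequency x₀ t) := by
  refine (Finset.measurable_sum _ fun k _ => ?_).div_const _
  exact (Measurable.of_discrete (f := ({x₀} : Set X).indicator (1 : X → ℝ))).comp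
    (measurable_pi_apply k)

/-- The weak law of large numbers for the frequency of a letter in an i.i.d. sequence. -/
theorem tendsto_measure_frequency_deviation (g : PMF X) (x₀ : X) {ε : ℝ} (hε : 0 < ε) :
    Tendsto (fun t => (Measure.infinitePi fun _ : ℕ => g.toMeasure).real
      {y | ε ≤ |frequency x₀ t y - (g x₀).toReal|}) atTop (𝓝 0) := by
  set μ := Measure.infinitePi fun _ : ℕ => g.toMeasure
  let φ : X → ℝ := ({x₀} : Set X).indicator 1
  have hφ : Measurable φ := .of_discrete
  have hmp (k : ℕ) : MeasurePreserving (fun y : ℕ → X => y k) μ g.toMeasure :=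
    measurePreserving_eval_infinitePi (fun _ : ℕ => g.toMeasure) k
  have hae := strong_law_ae_real (μ := μ) (fun k y => φ (y k)) ?_ ?_ ?_
  · have hint : ∫ y, φ (y 0) ∂μ = (g x₀).toReal := by
      rw [← integral_map (f := φ) (hmp 0).measurable.aemeasurable hφ.aestronglyMeasurable,
        (hmp 0).map_eq, integral_indicator_one (measurableSet_singleton _), Measure.real,
        PMF.toMeasure_apply_singleton _ _ (measurableSet_singleton _)]
    rw [hint] at hae
    have hm := tendstoInMeasure_of_tendsto_ae (μ := μ) (f := fun t => frequency x₀ t)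
      (fun t => (measurable_frequency x₀ t).aestronglyMeasurable) hae
    have := (ENNReal.continuousAt_toReal ENNReal.zero_ne_top).tendsto.comp
      (tendstoInMeasure_iff_dist.1 hm ε hε)
    simpa [Function.comp_def, Measure.real, Real.dist_eq] using this
  · exact (hmp 0).integrable_comp_of_integrable
      ((integrable_const (1 : ℝ)).indicator (measurableSet_singleton _))
  · intro j k hjk
    exact (iIndepFun_infinitePi (P := fun _ : ℕ => g.toMeasure) (X := fun _ => φ)
      (fun _ => hφ)).indepFun hjk
  · intro k
    exact ⟨(hφ.comp (hmp k).measurable).aemeasurable, (hφ.comp (hmp 0).measurable).aemeasurable, by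
      change μ.map (φ ∘ fun y => y k) = μ.map (φ ∘ fun y => y 0)
      rw [← Measure.map_map hφ (hmp k).measurable, ← Measure.map_map hφ (hmp 0).measurable,
        (hmp k).map_eq, (hmp 0).map_eq]⟩

end Frequencies

/-! ### Summation over the values of a finite observation. -/

section FiniteObservations

variable {Ω H : Type*} [MeasurableSpace Ω] [MeasurableSpace H]
  [MeasurableSingletonClass H]

theorem measureReal_inter_preimage_eq_sum [Fintype H] (μ : Measure Ω) [IsFiniteMeasure μ]
    {h : Ω → H} (hh : Measurable h) {E : Set Ω} (hE : MeasurableSet E) (S : Set H)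
    [DecidablePred (· ∈ S)] :
    μ.real (E ∩ h ⁻¹' S) = ∑ a with a ∈ S, μ.real (E ∩ h ⁻¹' {a}) := by
  rw [← measureReal_biUnion_finset]
  · congr 1
    ext ω
    simp
  · intro a _ b _ hab
    refine Set.disjoint_left.2 fun ω ha hb => hab ?_
    exact ha.2.symm.trans hb.2
  · exact fun a _ => hE.inter (hh (measurableSet_singleton a))

/-- An inequality between masses that holds given each value of a finitely valued observation holds
given any set of values. -/
theorem mul_measureReal_inter_preimage_le [Finite H] (μ ν : Measure Ω) [IsFiniteMeasure μ]
    [IsFiniteMeasure ν] {h : Ω → H} (hh : Measurable h) {E F : Set Ω} (hE : MeasurableSet E)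
    (hF : MeasurableSet F) (S : Set H) (c : ℝ)
    (hS : ∀ a ∈ S, c * μ.real (E ∩ h ⁻¹' {a}) ≤ ν.real (F ∩ h ⁻¹' {a})) :
    c * μ.real (E ∩ h ⁻¹' S) ≤ ν.real (F ∩ h ⁻¹' S) := by
  classical
  have := Fintype.ofFinite H
  rw [measureReal_inter_preimage_eq_sum μ hh hE, measureReal_inter_preimage_eq_sum ν hh hF,
    Finset.mul_sum]
  exact Finset.sum_le_sum fun a ha => hS a (Finset.mem_filter.1 ha).2

end FiniteObservations

/-! ### Conditional independence of the players given the public history. -/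

section Independence

variable (f : State → PMF X) (σ : Fin 2 → MixedStrategy X)
  (θ : State)

/-- The law in state `θ` of the signals and the pure strategy of player `i`. -/
def playerLaw (i : Fin 2) : Measure ((ℕ → X) × PureStrategy X) :=
  (Measure.infinitePi fun _ : ℕ => (f θ).toMeasure).prod (σ i : Measure (PureStrategy X))

instance (i : Fin 2) : IsProbabilityMeasure (playerLaw f σ θ i) := by
  unfold playerLaw; infer_instance

instance : IsProbabilityMeasure (signalLaw f θ) := by
  unfold signalLaw; infer_instance

/-- Both sides are products over pairs of a period and a player, curried in the two possible orders.
Grouping by player is what exposes independence across players. -/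
theorem signalLaw_eq_map_pi :
    signalLaw f θ = (Measure.pi fun _ : Fin 2 =>
      Measure.infinitePi fun _ : ℕ => (f θ).toMeasure).map fun y t i => y i t := by
  unfold signalLaw
  simp_rw [← Measure.infinitePi_eq_pi]
  rw [← Measure.infinitePi_map_curry (fun (_ : ℕ) (_ : Fin 2) => (f θ).toMeasure),
    ← Measure.infinitePi_map_curry (fun (_ : Fin 2) (_ : ℕ) => (f θ).toMeasure),
    ← Measure.map_infinitePi_infinitePi_of_inj (P := fun _ : Fin 2 × ℕ => (f θ).toMeasure)
      (f := (Prod.swap : ℕ × Fin 2 → Fin 2 × ℕ)) Prod.swap_injective,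
    Measure.map_map (by fun_prop) (by fun_prop), Measure.map_map (by fun_prop) (by fun_prop)]
  rfl

/-- The past action profiles, which are public. -/
def publicHistory {X : Type*} (t : ℕ) (ω : Outcome X) : Fin t → Fin 2 → Action :=
  fun k => ω.2.2 k

/-- The signals of player `i` up to period `t`. -/
def ownSignals {X : Type*} (i : Fin 2) (t : ℕ) (ω : Outcome X) : Fin (t + 1) → X :=
  fun k => ω.2.1 k i

theorem measurable_publicHistory (t : ℕ) : Measurable (publicHistory (X := X) t) := by
  unfold publicHistory; fun_prop

theorem measurable_ownSignals (i : Fin 2) (t : ℕ) : Measurable (ownSignals (X := X) i t) := by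
  unfold ownSignals; fun_prop

theorem measurable_privateHistory (i : Fin 2) (t : ℕ) :
    Measurable (privateHistory (X := X) i t) :=
  (measurable_publicHistory t).prodMk (measurable_ownSignals i t)

variable [Finite X]

theorem signalLaw_prod_eq_map_pi :
    (signalLaw f θ).prod (Measure.pi fun i => (σ i : Measure (PureStrategy X))) =
      (Measure.pi (playerLaw f σ θ)).map fun p => (fun t i => (p i).1 t, fun i => (p i).2) := by
  have h := (measurePreserving_arrowProdEquivProdArrow (ℕ → X) (PureStrategy X) (Fin 2)
    (fun _ => Measure.infinitePi fun _ : ℕ => (f θ).toMeasure)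
    (fun i => (σ i : Measure (PureStrategy X)))).map_eq
  have hsw : Measurable fun (y : Fin 2 → ℕ → X) t i => y i t := by fun_prop
  have hm := Measure.map_prod_map
    (Measure.pi fun _ : Fin 2 => Measure.infinitePi fun _ : ℕ => (f θ).toMeasure)
    (Measure.pi fun i => (σ i : Measure (PureStrategy X))) hsw measurable_id
  rw [Measure.map_id] at hm
  rw [signalLaw_eq_map_pi, hm, ← h, Measure.map_map (by fun_prop) (by fun_prop)]
  rfl

variable [DiscreteMeasurableSpace X]

instance : IsProbabilityMeasure (outcomeLaw f σ θ) := by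
  refine Measure.isProbabilityMeasure_map (Measurable.aemeasurable ?_)
  exact measurable_const.prodMk (measurable_fst.prodMk measurable_play)

/-- Strategies affect actions but not signals, so individual learning does not depend on `σ`. -/
theorem map_signals_outcomeLaw (i : Fin 2) :
    (outcomeLaw f σ θ).map (fun ω t => ω.2.1 t i) =
      Measure.infinitePi fun _ : ℕ => (f θ).toMeasure := by
  have hp := measurable_play (X := X)
  have hq : Measurable fun r : (ℕ → Fin 2 → X) × (Fin 2 → PureStrategy X) =>
      (θ, r.1, play r.2 r.1) := measurable_const.prodMk (measurable_fst.prodMk hp)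
  rw [outcomeLaw, Measure.map_map (by fun_prop) hq, signalLaw_prod_eq_map_pi,
    Measure.map_map (by exact Measurable.comp (by fun_prop) hq) (by fun_prop)]
  have : (Measure.pi (playerLaw f σ θ)).map (fun p => (p i).1) =
      Measure.infinitePi fun _ : ℕ => (f θ).toMeasure := by
    have := Measure.map_map (μ := Measure.pi (playerLaw f σ θ)) (f := Function.eval i)
      (g := Prod.fst) measurable_fst (measurable_pi_apply i)
    refine this.symm.trans ?_
    rw [ (measurePreserving_eval (playerLaw f σ θ) i).map_eq, playerLaw]
    exact Measure.fst_prod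
  exact this

/-- The signals and strategies of player `i` with signals in `Y` up to period `t` that choose the
actions of `i` in `a` as long as the public history agrees with `a`. -/
def consistent {X : Type*} (i : Fin 2) {t : ℕ} (a : Fin t → Fin 2 → Action)
    (Y : Set (Fin (t + 1) → X)) : Set ((ℕ → X) × PureStrategy X) :=
  {z | (fun k => z.1 k.val) ∈ Y ∧
    ∀ k : Fin t, z.2 ⟨k, fun l => a ⟨l, l.isLt.trans k.isLt⟩, fun l => z.1 l⟩ = a k i}

/-- The strategies are evaluated along the prescribed path `a`, not along actual play, so the
condition for `i` involves only his own strategy and signals. Induction on the period shows that the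
two paths agree. -/
theorem play_eq_iff {X : Type*} (s : Fin 2 → PureStrategy X) (x : ℕ → Fin 2 → X) {t : ℕ}
    (a : Fin t → Fin 2 → Action) :
    (fun k : Fin t => play s x k) = a ↔ ∀ (i : Fin 2) (k : Fin t),
      s i ⟨k, fun l => a ⟨l, l.isLt.trans k.isLt⟩, fun l => x l i⟩ = a k i := by
  constructor
  · rintro rfl i k
    dsimp only
    rw [play]
  · intro h
    funext ⟨k, hk⟩
    induction k using Nat.strong_induction_on with
    | _ k ih =>
      funext i
      dsimp only
      rw [← h i ⟨k, hk⟩, play]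
      congr 3
      funext l
      exact ih l l.isLt (l.isLt.trans hk)

/-- By `play_eq_iff` the event is a rectangle in the independent pairs of signals and strategy. -/
theorem outcomeLaw_publicHistory_ownSignals {t : ℕ} (a : Fin t → Fin 2 → Action)
    (Y : Fin 2 → Set (Fin (t + 1) → X)) :
    (outcomeLaw f σ θ).real {ω | publicHistory t ω = a ∧ ∀ i, ownSignals i t ω ∈ Y i} =
      ∏ i, (playerLaw f σ θ i).real (consistent i a (Y i)) := by
  have hq : Measurable fun r : (ℕ → Fin 2 → X) × (Fin 2 → PureStrategy X) =>
      (θ, r.1, play r.2 r.1) := measurable_const.prodMk (measurable_fst.prodMk measurable_play)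
  have hset : MeasurableSet
      {ω : Outcome X | publicHistory t ω = a ∧ ∀ i, ownSignals i t ω ∈ Y i} := by
    refine MeasurableSet.inter (measurable_publicHistory t (measurableSet_singleton a)) ?_
    change MeasurableSet {ω : Outcome X | ∀ i, ownSignals i t ω ∈ Y i}
    rw [Set.ofPred_forall]
    exact MeasurableSet.iInter fun i => measurable_ownSignals i t (Set.toFinite (Y i)).measurableSet
  rw [Measure.real, outcomeLaw, Measure.map_apply hq hset, signalLaw_prod_eq_map_pi,
    Measure.map_apply (by fun_prop) (hq hset)]
  simp_rw [Measure.real]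
  rw [← ENNReal.toReal_prod, ← Measure.pi_pi]
  congr 2
  ext p
  have hplay := play_eq_iff (fun i => (p i).2) (fun t i => (p i).1 t) a
  exact ⟨fun h i _ => ⟨h.2 i, hplay.1 h.1 i⟩, fun h =>
    ⟨hplay.2 fun i => (h i trivial).2, fun i => (h i trivial).1⟩⟩

/-- In each state, the private histories of the two players are independent conditional on the
public history. -/
theorem condIndep_privateHistory {i j : Fin 2} (hij : i ≠ j) {t : ℕ}
    (h : PrivateHistory X t) (S : Set (PrivateHistory X t)) :
    (outcomeLaw f σ θ).real (privateHistory i t ⁻¹' {h} ∩ privateHistory j t ⁻¹' S) *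
        (outcomeLaw f σ θ).real (publicHistory t ⁻¹' {h.1}) =
      (outcomeLaw f σ θ).real (privateHistory i t ⁻¹' {h}) *
        (outcomeLaw f σ θ).real (privateHistory j t ⁻¹' S ∩ publicHistory t ⁻¹' {h.1}) := by
  obtain ⟨a, y⟩ := h
  -- Allowing `Set.univ` for `Y` or `Z`, this factorises all four probabilities in the goal.
  have key (Y Z : Set (Fin (t + 1) → X)) :
      (outcomeLaw f σ θ).real {ω | publicHistory t ω = a ∧ ownSignals i t ω ∈ Y ∧
        ownSignals j t ω ∈ Z} =
      (playerLaw f σ θ i).real (consistent i a Y) *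
        (playerLaw f σ θ j).real (consistent j a Z) := by
    have hY := outcomeLaw_publicHistory_ownSignals f σ θ a (fun k => if k = i then Y else Z)
    have huniv : (Finset.univ : Finset (Fin 2)) = {i, j} := by
      clear hY; revert i j; decide
    rw [huniv, Finset.prod_pair hij, if_pos rfl, if_neg hij.symm] at hY
    rw [← hY]
    congr 1
    ext ω
    have hall (p : Fin 2 → Prop) : (∀ k, p k) ↔ p i ∧ p j := by
      have : (∀ k, p k) ↔ ∀ k ∈ (Finset.univ : Finset (Fin 2)), p k := by simp
      rw [this, huniv]; simp
    simp only [Set.mem_ofPred_eq, hall, if_true, if_neg hij.symm]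
  let Z : Set (Fin (t + 1) → X) := {z | (a, z) ∈ S}
  have e₁ : privateHistory i t ⁻¹' {(a, y)} ∩ privateHistory j t ⁻¹' S =
      {ω | publicHistory t ω = a ∧ ownSignals i t ω ∈ ({y} : Set _) ∧ ownSignals j t ω ∈ Z} := by
    ext ω
    change ((publicHistory t ω, ownSignals i t ω) = (a, y) ∧
      (publicHistory t ω, ownSignals j t ω) ∈ S) ↔ _
    simp only [Prod.mk.injEq, Set.mem_ofPred_eq, Set.mem_singleton_iff, Z]
    constructor
    · rintro ⟨⟨rfl, h⟩, h'⟩; exact ⟨rfl, h, h'⟩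
    · rintro ⟨rfl, h, h'⟩; exact ⟨⟨rfl, h⟩, h'⟩
  have e₂ : publicHistory t ⁻¹' {a} = {ω : Outcome X | publicHistory t ω = a ∧
      ownSignals i t ω ∈ Set.univ ∧ ownSignals j t ω ∈ Set.univ} := by
    ext ω; simp
  have e₃ : privateHistory i t ⁻¹' {(a, y)} = {ω | publicHistory t ω = a ∧
      ownSignals i t ω ∈ ({y} : Set _) ∧ ownSignals j t ω ∈ Set.univ} := by
    ext ω
    change (publicHistory t ω, ownSignals i t ω) = (a, y) ↔ _
    simp
  have e₄ : privateHistory j t ⁻¹' S ∩ publicHistory t ⁻¹' {a} = {ω | publicHistory t ω = a ∧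
      ownSignals i t ω ∈ Set.univ ∧ ownSignals j t ω ∈ Z} := by
    ext ω
    change ((publicHistory t ω, ownSignals j t ω) ∈ S ∧ publicHistory t ω = a) ↔ _
    simp only [Set.mem_ofPred_eq, Set.mem_univ, true_and, Z]
    constructor
    · rintro ⟨h, rfl⟩; exact ⟨rfl, h⟩
    · rintro ⟨rfl, h⟩; exact ⟨h, rfl⟩
  dsimp only
  rw [e₁, e₄, e₂, e₃, key, key, key, key]
  ring

end Independence

/-! ### Beliefs, evident events and common belief. -/

section Beliefs

theorem measurableSet_stateEvent (θ : State) : MeasurableSet (stateEvent X θ) :=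
  measurable_fst (measurableSet_singleton θ)

theorem belief_eq_div (P : Measure (Outcome X)) [DiscreteMeasurableSpace X] [Finite X] (i : Fin 2)
    (t : ℕ) (F : Set (Outcome X)) (ω : Outcome X) :
    belief P i t F ω = P.real (F ∩ privateHistory i t ⁻¹' {privateHistory i t ω}) /
      P.real (privateHistory i t ⁻¹' {privateHistory i t ω}) := by
  have hm : MeasurableSet (privateHistory i t ⁻¹' {privateHistory (X := X) i t ω}) :=
    measurable_privateHistory i t (measurableSet_singleton _)
  change (cond P (privateHistory i t ⁻¹' {privateHistory i t ω})).real F = _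
  rw [Measure.real, cond_apply hm, ENNReal.toReal_mul, ENNReal.toReal_inv, Set.inter_comm,
    div_eq_inv_mul]
  rfl

theorem belief_mono (P : Measure (Outcome X)) (i : Fin 2) (t : ℕ) {F G : Set (Outcome X)}
    (h : F ⊆ G) (ω : Outcome X) : belief P i t F ω ≤ belief P i t G ω :=
  measureReal_mono h

theorem bothBelieve_mono (P : Measure (Outcome X)) (q : ℝ) (t : ℕ) :
    Monotone (bothBelieve P q t) := fun _ _ h _ hω =>
  ⟨hω.1.trans (belief_mono P 0 t h _), hω.2.trans (belief_mono P 1 t h _)⟩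

/-- A `q`-evident event contained in `E` is contained in the event that `E` is common
`q`-belief. -/
theorem subset_commonBelief (P : Measure (Outcome X)) (q : ℝ) (t : ℕ) {E F : Set (Outcome X)}
    (hFE : F ⊆ E) (hF : F ⊆ bothBelieve P q t F) : F ⊆ commonBelief P q t E := by
  refine Set.subset_iInter₂ fun n hn => ?_
  -- The inclusion also holds for the zeroth iterate, `E` itself, where the induction starts.
  clear hn
  induction n with
  | zero => exact hFE
  | succ n ih =>
    rw [Function.iterate_succ_apply']
    exact hF.trans (bothBelieve_mono P q t ih)

/-- The private histories at which the player believes `F` with probability at least `q`. -/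
def believingHistories (P : Measure (Outcome X)) (q : ℝ) (i : Fin 2) (t : ℕ)
    (F : Set (Outcome X)) : Set (PrivateHistory X t) :=
  {h | q ≤ P.real (F ∩ privateHistory i t ⁻¹' {h}) / P.real (privateHistory i t ⁻¹' {h})}

theorem playerBelieves_eq_preimage [DiscreteMeasurableSpace X] [Finite X]
    (P : Measure (Outcome X)) (q : ℝ) (i : Fin 2) (t : ℕ) (F : Set (Outcome X)) :
    playerBelieves P q i t F = privateHistory i t ⁻¹' believingHistories P q i t F := by
  ext ω
  change q ≤ belief P i t F ω ↔ _
  rw [belief_eq_div]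
  rfl

theorem measurableSet_playerBelieves [DiscreteMeasurableSpace X] [Finite X]
    (P : Measure (Outcome X)) (q : ℝ) (i : Fin 2) (t : ℕ) (F : Set (Outcome X)) :
    MeasurableSet (playerBelieves P q i t F) := by
  rw [playerBelieves_eq_preimage]
  exact measurable_privateHistory i t (Set.toFinite _).measurableSet

/-- On an event observed by the player, failing to believe a true event `F` is at most as likely,
up to a constant, as `F` being false. -/
theorem mul_measureReal_not_playerBelieves_le [DiscreteMeasurableSpace X] [Finite X]
    (P : Measure (Outcome X)) [IsFiniteMeasure P] {r : ℝ} (hr : r ≤ 1) (i : Fin 2) (t : ℕ)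
    {F : Set (Outcome X)} (hF : MeasurableSet F) (A : Set (PrivateHistory X t)) :
    (1 - r) * P.real (F ∩ ((playerBelieves P r i t F)ᶜ ∩ privateHistory i t ⁻¹' A)) ≤
      P.real (Fᶜ ∩ privateHistory i t ⁻¹' A) := by
  rw [playerBelieves_eq_preimage, ← Set.preimage_compl, ← Set.preimage_inter]
  refine (mul_measureReal_inter_preimage_le P P (measurable_privateHistory i t) hF hF.compl _ _
    fun h hh => ?_).trans (measureReal_mono (by gcongr; exact Set.inter_subset_right))
  have hsum : P.real (F ∩ privateHistory i t ⁻¹' {h}) + P.real (Fᶜ ∩ privateHistory i t ⁻¹' {h}) =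
      P.real (privateHistory i t ⁻¹' {h}) := by
    rw [Set.inter_comm F, Set.inter_comm Fᶜ, ← Set.sdiff_eq]
    exact measureReal_inter_add_sdiff hF
  have hlt : P.real (F ∩ privateHistory i t ⁻¹' {h}) / P.real (privateHistory i t ⁻¹' {h}) < r :=
    not_le.1 hh.1
  have h₁ : 0 ≤ P.real (F ∩ privateHistory i t ⁻¹' {h}) := measureReal_nonneg
  have h₂ : 0 ≤ P.real (Fᶜ ∩ privateHistory i t ⁻¹' {h}) := measureReal_nonneg
  -- Histories of probability zero may count as disbelieving, since belief there is `0`, but they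
  -- carry no mass.
  rcases eq_or_lt_of_le (measureReal_nonneg (μ := P) (s := privateHistory i t ⁻¹' {h})) with h0 | h0
  · have : P.real (F ∩ privateHistory i t ⁻¹' {h}) = 0 := by linarith
    rw [this, mul_zero]
    exact h₂
  · rw [div_lt_iff₀ h0] at hlt
    have : 0 ≤ (1 - r) * P.real (Fᶜ ∩ privateHistory i t ⁻¹' {h}) :=
      mul_nonneg (by linarith) h₂
    nlinarith

end Beliefs

/-! ### Conditioning on the state. -/

section States

/-- The state of nature that is not `θ`. -/
def State.other : State → State
  | .H => .L
  | .L => .H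

/-- The prior probability of the state `θ`. -/
def prior (p₀ : ℝ) : State → ℝ
  | .H => p₀
  | .L => 1 - p₀

theorem compl_stateEvent {X : Type*} (θ : State) : (stateEvent X θ)ᶜ = stateEvent X θ.other := by
  ext ⟨η, x⟩
  cases η <;> cases θ <;> simp [stateEvent, State.other]

theorem prior_pos {p₀ : ℝ} (hp₀ : 0 < p₀) (hp₁ : p₀ < 1) (θ : State) : 0 < prior p₀ θ := by
  cases θ
  · exact hp₀
  · exact sub_pos.2 hp₁

variable [Finite X] [DiscreteMeasurableSpace X] (f : State → PMF X) (σ : Fin 2 → MixedStrategy X)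

theorem outcomeLaw_stateEvent_compl (θ : State) : outcomeLaw f σ θ (stateEvent X θ)ᶜ = 0 := by
  rw [outcomeLaw, Measure.map_apply (measurable_const.prodMk
    (measurable_fst.prodMk measurable_play)) (measurableSet_stateEvent θ).compl]
  refine (congrArg _ (Set.eq_empty_of_forall_notMem fun r hr => ?_)).trans measure_empty
  exact hr rfl

instance (p₀ : ℝ) : IsFiniteMeasure (outcomeMeasure p₀ f σ) := by
  have (c : ℝ) (θ : State) : IsFiniteMeasure (ENNReal.ofReal c • outcomeLaw f σ θ) :=
    Measure.smul_finite _ ENNReal.ofReal_ne_top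
  unfold outcomeMeasure
  infer_instance

/-- The two outcome laws are carried by disjoint state events, so only one term of the mixture
survives. -/
theorem outcomeMeasure_real_stateEvent_inter {p₀ : ℝ} (hp₀ : 0 < p₀) (hp₁ : p₀ < 1) (θ : State)
    (A : Set (Outcome X)) :
    (outcomeMeasure p₀ f σ).real (stateEvent X θ ∩ A) = prior p₀ θ * (outcomeLaw f σ θ).real A := by
  have h₁ (η : State) : outcomeLaw f σ η (stateEvent X η ∩ A) = outcomeLaw f σ η A := by
    refine le_antisymm (measure_mono Set.inter_subset_right) ?_
    rw [← add_zero (outcomeLaw f σ η (_ ∩ A)), ← outcomeLaw_stateEvent_compl f σ η]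
    refine (measure_mono fun ω hω => ?_).trans (measure_union_le _ _)
    by_cases h : ω ∈ stateEvent X η
    · exact .inl ⟨h, hω⟩
    · exact .inr h
  have h₂ (η : State) : outcomeLaw f σ η (stateEvent X η.other ∩ A) = 0 :=
    measure_mono_null (Set.inter_subset_left.trans (compl_stateEvent η).symm.subset)
      (outcomeLaw_stateEvent_compl f σ η)
  have hH := h₂ .H
  have hL := h₂ .L
  simp only [State.other] at hH hL
  cases θ <;> simp only [Measure.real, outcomeMeasure, Measure.add_apply, Measure.smul_apply,
    smul_eq_mul, h₁, hH, hL, mul_zero, add_zero, zero_add, ENNReal.toReal_mul, prior]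
  · rw [ENNReal.toReal_ofReal hp₀.le]
  · rw [ENNReal.toReal_ofReal (by linarith)]

theorem cond_outcomeMeasure_stateEvent_real {p₀ : ℝ} (hp₀ : 0 < p₀) (hp₁ : p₀ < 1) (θ : State)
    (A : Set (Outcome X)) :
    (cond (outcomeMeasure p₀ f σ) (stateEvent X θ)).real A = (outcomeLaw f σ θ).real A := by
  have h := outcomeMeasure_real_stateEvent_inter f σ hp₀ hp₁ θ
  have h1 := h Set.univ
  rw [Set.inter_univ, probReal_univ, mul_one] at h1
  rw [Measure.real, cond_apply (measurableSet_stateEvent θ), ENNReal.toReal_mul,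
    ENNReal.toReal_inv]
  change ((outcomeMeasure p₀ f σ).real _)⁻¹ * (outcomeMeasure p₀ f σ).real _ = _
  rw [h, h1, inv_mul_cancel_left₀ (prior_pos hp₀ hp₁ θ).ne']

end States

/-! ### Individual and common learning. -/

section Learning

variable [Finite X] [DiscreteMeasurableSpace X] {f : State → PMF X} (σ : Fin 2 → MixedStrategy X)

theorem tendsto_outcomeLaw_frequency_deviation (θ : State) (i : Fin 2) (x₀ : X) {ε : ℝ}
    (hε : 0 < ε) :
    Tendsto (fun t => (outcomeLaw f σ θ).real
      {ω | ε ≤ |frequency x₀ t (fun k => ω.2.1 k i) - (f θ x₀).toReal|}) atTop (𝓝 0) := by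
  refine (tendsto_measure_frequency_deviation (f θ) x₀ hε).congr fun t => ?_
  rw [← map_signals_outcomeLaw f σ θ i, Measure.real, Measure.map_apply (by fun_prop)]
  · rfl
  · exact measurableSet_le measurable_const ((measurable_frequency x₀ t).sub_const _).abs

/-- Each player learns the state. -/
theorem tendsto_not_playerBelieves (hf : f .H ≠ f .L) {p₀ : ℝ} (hp₀ : 0 < p₀) (hp₁ : p₀ < 1)
    (θ : State) (i : Fin 2) {r : ℝ} (hr : r < 1) :
    Tendsto (fun t => (outcomeLaw f σ θ).real
      (playerBelieves (outcomeMeasure p₀ f σ) r i t (stateEvent X θ))ᶜ) atTop (𝓝 0) := by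
  obtain ⟨x₀, hx₀⟩ : ∃ x, f θ x ≠ f θ.other x := by
    by_contra! h
    cases θ
    · exact hf (PMF.ext h)
    · exact hf (PMF.ext h).symm
  set P := outcomeMeasure p₀ f σ
  have hne : (f θ x₀).toReal ≠ (f θ.other x₀).toReal := fun h =>
    hx₀ ((ENNReal.toReal_eq_toReal_iff' (PMF.apply_ne_top _ _) (PMF.apply_ne_top _ _)).1 h)
  -- With half the gap, a frequency within `ε` of its value in one state is at least `ε` away from
  -- its value in the other.
  set ε := |(f θ x₀).toReal - (f θ.other x₀).toReal| / 2 with hε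
  have hε0 : 0 < ε := half_pos (abs_pos.2 (sub_ne_zero.2 hne))
  let D (η : State) (t : ℕ) : Set (Outcome X) :=
    {ω | ε ≤ |frequency x₀ t (fun k => ω.2.1 k i) - (f η x₀).toReal|}
  -- The prior odds against `θ`, times the factor lost to the belief threshold.
  set c := (prior p₀ θ.other / (prior p₀ θ * (1 - r)))
  have hD (η : State) : Tendsto (fun t => (outcomeLaw f σ η).real (D η t)) atTop (𝓝 0) :=
    tendsto_outcomeLaw_frequency_deviation σ η i x₀ hε0
  have hlim := (hD θ).add ((hD θ.other).const_mul c)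
  rw [mul_zero, add_zero] at hlim
  refine squeeze_zero (fun _ => measureReal_nonneg) (fun t => ?_) hlim
  -- The frequency uses only `t` of the `t + 1` signals in the private history, so the player
  -- observes whether it is typical of `θ`.
  let A : Set (PrivateHistory X t) :=
    {h | ¬ ε ≤ |(∑ k : Fin t, ({x₀} : Set X).indicator 1 (h.2 k.castSucc)) / t - (f θ x₀).toReal|}
  have hA : privateHistory i t ⁻¹' A = (D θ t)ᶜ := by
    ext ω
    simp only [Set.mem_preimage, Set.mem_compl_iff, D, A, frequency, Finset.sum_range]
    rfl
  have hsub : (D θ t)ᶜ ⊆ D θ.other t := by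
    intro ω hω
    have hω : ¬ ε ≤ |frequency x₀ t (fun k => ω.2.1 k i) - (f θ x₀).toReal| := hω
    change ε ≤ |frequency x₀ t (fun k => ω.2.1 k i) - (f θ.other x₀).toReal|
    have := abs_sub_le (f θ x₀).toReal (frequency x₀ t (fun k => ω.2.1 k i))
      (f θ.other x₀).toReal
    rw [abs_sub_comm (f θ x₀).toReal (frequency _ _ _)] at this
    linarith
  have hm := mul_measureReal_not_playerBelieves_le P hr.le i t (measurableSet_stateEvent θ) A
  rw [compl_stateEvent, outcomeMeasure_real_stateEvent_inter f σ hp₀ hp₁,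
    outcomeMeasure_real_stateEvent_inter f σ hp₀ hp₁, hA] at hm
  set B := (playerBelieves P r i t (stateEvent X θ))ᶜ
  have hpos := prior_pos hp₀ hp₁ θ
  have hpos' := prior_pos hp₀ hp₁ θ.other
  have hr' : 0 < 1 - r := sub_pos.2 hr
  have hB : (outcomeLaw f σ θ).real (B ∩ (D θ t)ᶜ) ≤
      c * (outcomeLaw f σ θ.other).real (D θ.other t) := by
    rw [div_mul_eq_mul_div, le_div_iff₀ (by positivity)]
    have : (outcomeLaw f σ θ.other).real (D θ t)ᶜ ≤ (outcomeLaw f σ θ.other).real (D θ.other t) :=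
      measureReal_mono hsub
    have := mul_le_mul_of_nonneg_left this hpos'.le
    linarith
  calc (outcomeLaw f σ θ).real B
      ≤ (outcomeLaw f σ θ).real (D θ t ∪ B ∩ (D θ t)ᶜ) := by
        refine measureReal_mono fun ω hω => ?_
        by_cases h : ω ∈ D θ t
        · exact .inl h
        · exact .inr ⟨hω, h⟩
    _ ≤ _ := (measureReal_union_le _ _).trans (by gcongr)

/-- The public histories given which, in state `θ`, player `i` believes in `θ` with high
probability. -/
def reassuringHistories (f : State → PMF X) (σ : Fin 2 → MixedStrategy X) (p₀ r : ℝ) (θ : State)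
    (i : Fin 2) (t : ℕ) : Set (Fin t → Fin 2 → Action) :=
  {a | r * (outcomeLaw f σ θ).real (publicHistory t ⁻¹' {a}) ≤ (outcomeLaw f σ θ).real
    (playerBelieves (outcomeMeasure p₀ f σ) r i t (stateEvent X θ) ∩ publicHistory t ⁻¹' {a})}

/-- Markov's inequality: given a public history outside the set, disbelief has conditional
probability above `1 - r`. -/
theorem mul_measureReal_not_reassuringHistories_le (p₀ r : ℝ) (θ : State) (i : Fin 2) (t : ℕ) :
    (1 - r) * (outcomeLaw f σ θ).real
        (publicHistory t ⁻¹' reassuringHistories f σ p₀ r θ i t)ᶜ ≤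
      (outcomeLaw f σ θ).real
        (playerBelieves (outcomeMeasure p₀ f σ) r i t (stateEvent X θ))ᶜ := by
  set B := playerBelieves (outcomeMeasure p₀ f σ) r i t (stateEvent X θ)
  have hB : MeasurableSet B := measurableSet_playerBelieves _ _ _ _ _
  have := mul_measureReal_inter_preimage_le (outcomeLaw f σ θ) (outcomeLaw f σ θ)
    (measurable_publicHistory t) MeasurableSet.univ hB.compl
    (reassuringHistories f σ p₀ r θ i t)ᶜ (1 - r) fun a ha => ?_
  · rw [Set.univ_inter, Set.preimage_compl] at this
    exact this.trans (measureReal_mono Set.inter_subset_left)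
  · have hsum : (outcomeLaw f σ θ).real (B ∩ publicHistory t ⁻¹' {a}) +
        (outcomeLaw f σ θ).real (Bᶜ ∩ publicHistory t ⁻¹' {a}) =
        (outcomeLaw f σ θ).real (publicHistory t ⁻¹' {a}) := by
      rw [Set.inter_comm B, Set.inter_comm Bᶜ, ← Set.sdiff_eq]
      exact measureReal_inter_add_sdiff hB
    have hlt : (outcomeLaw f σ θ).real (B ∩ publicHistory t ⁻¹' {a}) <
      r * (outcomeLaw f σ θ).real (publicHistory t ⁻¹' {a}) := not_le.1 ha
    rw [Set.univ_inter]
    linarith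

/-- The event that the state is `θ`, both players believe so, and each of them could expect this
of the other from the public history. -/
def evidentEvent (f : State → PMF X) (σ : Fin 2 → MixedStrategy X) (p₀ r : ℝ) (θ : State)
    (t : ℕ) : Set (Outcome X) :=
  stateEvent X θ ∩ ⋂ i, (playerBelieves (outcomeMeasure p₀ f σ) r i t (stateEvent X θ) ∩
    publicHistory t ⁻¹' reassuringHistories f σ p₀ r θ i t)

/-- Player `i` knows the public history and his own belief, so he is uncertain only about the state
and the belief of `j`. One factor `r` bounds each. -/
theorem le_belief_evidentEvent {p₀ r : ℝ} (hp₀ : 0 < p₀) (hp₁ : p₀ < 1) (hr : 0 < r) {θ : State}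
    {t : ℕ} {i j : Fin 2} (hij : i ≠ j) {ω : Outcome X} (hω : ω ∈ evidentEvent f σ p₀ r θ t) :
    r * r ≤ belief (outcomeMeasure p₀ f σ) i t (evidentEvent f σ p₀ r θ t) ω := by
  set P := outcomeMeasure p₀ f σ
  have hω' := Set.mem_iInter.1 hω.2
  set h := privateHistory i t ω with hh
  have hcover (k : Fin 2) : k = i ∨ k = j := by
    clear_value h; clear hh hω' hω h; revert k i j; decide
  have hsub : stateEvent X θ ∩ (privateHistory i t ⁻¹' {h} ∩
      playerBelieves P r j t (stateEvent X θ)) ⊆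
      evidentEvent f σ p₀ r θ t ∩ privateHistory i t ⁻¹' {h} := by
    rintro ω₁ ⟨hθ, hi, hj⟩
    have hi : privateHistory i t ω₁ = privateHistory i t ω := hi
    have hpub : publicHistory t ω₁ = publicHistory t ω := congrArg Prod.fst hi
    refine ⟨⟨hθ, Set.mem_iInter.2 fun k => ⟨?_, ?_⟩⟩, hi⟩
    · rcases hcover k with rfl | rfl
      · have := (hω' k).1
        rw [playerBelieves_eq_preimage] at this ⊢
        rwa [Set.mem_preimage, hi]
      · exact hj
    · rw [Set.mem_preimage, hpub]
      exact (hω' k).2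
  have hbel : r ≤ belief P i t (stateEvent X θ) ω := (hω' i).1
  rw [belief_eq_div, ← hh] at hbel ⊢
  -- At a null history the belief would be `0`, below `r`.
  have hpos : 0 < P.real (privateHistory i t ⁻¹' {h}) := by
    refine lt_of_le_of_ne measureReal_nonneg fun h0 => ?_
    rw [← h0, div_zero] at hbel
    exact hr.not_ge hbel
  rw [le_div_iff₀ hpos] at hbel ⊢
  refine le_trans ?_ (measureReal_mono hsub)
  rw [outcomeMeasure_real_stateEvent_inter f σ hp₀ hp₁] at hbel ⊢
  -- Conditional independence carries the bound on the belief of `j` from the public history over to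
  -- the private history of `i`.
  have hci := condIndep_privateHistory f σ θ hij h (believingHistories P r j t (stateEvent X θ))
  rw [← playerBelieves_eq_preimage] at hci
  have hreas : r * (outcomeLaw f σ θ).real (publicHistory t ⁻¹' {h.1}) ≤ (outcomeLaw f σ θ).real
    (playerBelieves P r j t (stateEvent X θ) ∩ publicHistory t ⁻¹' {h.1}) := (hω' j).2
  have hprior := prior_pos hp₀ hp₁ θ
  have hhist : 0 < (outcomeLaw f σ θ).real (privateHistory i t ⁻¹' {h}) := by
    have := lt_of_lt_of_le (mul_pos hr hpos) hbel
    exact pos_of_mul_pos_right this hprior.le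
  have hpub : 0 < (outcomeLaw f σ θ).real (publicHistory t ⁻¹' {h.1}) :=
    hhist.trans_le (measureReal_mono fun ω₁ h₁ => congrArg Prod.fst h₁)
  have hkey : r * (outcomeLaw f σ θ).real (privateHistory i t ⁻¹' {h}) ≤ (outcomeLaw f σ θ).real
      (privateHistory i t ⁻¹' {h} ∩ playerBelieves P r j t (stateEvent X θ)) := by
    refine le_of_mul_le_mul_right ?_ hpub
    rw [hci]
    have := mul_le_mul_of_nonneg_left hreas hhist.le
    linarith
  have h₁ := mul_le_mul_of_nonneg_left hkey hprior.le
  have h₂ := mul_le_mul_of_nonneg_left hbel hr.le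
  linarith

theorem tendsto_evidentEvent (hf : f .H ≠ f .L) {p₀ r : ℝ} (hp₀ : 0 < p₀) (hp₁ : p₀ < 1)
    (hr : r < 1) (θ : State) :
    Tendsto (fun t => (outcomeLaw f σ θ).real (evidentEvent f σ p₀ r θ t)) atTop (𝓝 1) := by
  have hlim : Tendsto (fun t => 1 - ∑ i, ((outcomeLaw f σ θ).real
      (playerBelieves (outcomeMeasure p₀ f σ) r i t (stateEvent X θ))ᶜ +
      (1 - r)⁻¹ * (outcomeLaw f σ θ).real
      (playerBelieves (outcomeMeasure p₀ f σ) r i t (stateEvent X θ))ᶜ)) atTop (𝓝 1) := by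
    have h := fun i => tendsto_not_playerBelieves σ hf hp₀ hp₁ θ i hr
    have := (tendsto_finsetSum Finset.univ fun i _ => (h i).add ((h i).const_mul (1 - r)⁻¹)).const_sub
      1
    simpa using this
  refine tendsto_of_tendsto_of_tendsto_of_le_of_le hlim tendsto_const_nhds (fun t => ?_)
    fun t => measureReal_le_one
  dsimp only
  set E := evidentEvent f σ p₀ r θ t
  have hcompl : 1 ≤ (outcomeLaw f σ θ).real E + (outcomeLaw f σ θ).real Eᶜ := by
    rw [← probReal_univ (μ := outcomeLaw f σ θ), ← Set.union_compl_self E]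
    exact measureReal_union_le _ _
  have hEc : Eᶜ ⊆ (stateEvent X θ)ᶜ ∪
      ⋃ i, ((playerBelieves (outcomeMeasure p₀ f σ) r i t (stateEvent X θ))ᶜ ∪
        (publicHistory t ⁻¹' reassuringHistories f σ p₀ r θ i t)ᶜ) := by
    simp only [E, evidentEvent, Set.compl_inter, Set.compl_iInter, subset_rfl]
  have h0 : (outcomeLaw f σ θ).real (stateEvent X θ)ᶜ = 0 := by
    rw [Measure.real, outcomeLaw_stateEvent_compl, ENNReal.toReal_zero]
  have hbound := (measureReal_mono (μ := outcomeLaw f σ θ) hEc).trans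
    ((measureReal_union_le _ _).trans (add_le_add_right ((measureReal_iUnion_fintype_le _).trans
      (Finset.sum_le_sum fun i _ => (measureReal_union_le _ _).trans
        (add_le_add_right (?_ : _ ≤ (1 - r)⁻¹ * (outcomeLaw f σ θ).real
          (playerBelieves (outcomeMeasure p₀ f σ) r i t (stateEvent X θ))ᶜ) _))) _))
  · linarith
  · rw [inv_mul_eq_div, le_div_iff₀ (sub_pos.2 hr), mul_comm]
    exact mul_measureReal_not_reassuringHistories_le σ p₀ r θ i t

theorem commonlyLearn_outcomeMeasure {p₀ : ℝ} (hp₀ : 0 < p₀) (hp₁ : p₀ < 1) (hf : f .H ≠ f .L)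
    (θ : State) : CommonlyLearn (outcomeMeasure p₀ f σ) θ := by
  intro q hq₀ hq₁
  -- The threshold `r = (1 + q) / 2` works because `r * r - q = ((1 - q) / 2) ^ 2`.
  have hr : (1 + q) / 2 < 1 := by linarith
  have hr₀ : 0 < (1 + q) / 2 := by linarith
  have hqr : q ≤ (1 + q) / 2 * ((1 + q) / 2) := by nlinarith [sq_nonneg (1 - q)]
  obtain ⟨T, hT⟩ := eventually_atTop.1
    ((tendsto_evidentEvent σ hf hp₀ hp₁ hr θ).eventually_const_lt hq₁)
  refine ⟨T, fun t ht => ?_⟩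
  rw [cond_outcomeMeasure_stateEvent_real f σ hp₀ hp₁]
  refine (hT t ht).trans_le (measureReal_mono (subset_commonBelief _ q t Set.inter_subset_left
    fun ω hω => ⟨hqr.trans ?_, hqr.trans ?_⟩))
  · exact le_belief_evidentEvent σ hp₀ hp₁ hr₀ zero_ne_one hω
  · exact le_belief_evidentEvent σ hp₀ hp₁ hr₀ one_ne_zero hω

end Learning

end InvestmentGame

end

theorem mainTheorem4 {X : Type*} [Finite X] [MeasurableSpace X] [DiscreteMeasurableSpace X]
    (p₀ : ℝ) (hp₀ : 0 < p₀) (hp₁ : p₀ < 1)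
    (f : InvestmentGame.State → PMF X)
    (hsupp : ∀ (θ : InvestmentGame.State) (x : X), 0 < f θ x)
    (hf : f InvestmentGame.State.H ≠ f InvestmentGame.State.L)
    (σ : Fin 2 → InvestmentGame.MixedStrategy X) (θ : InvestmentGame.State) :
    InvestmentGame.CommonlyLearn (InvestmentGame.outcomeMeasure p₀ f σ) θ := by
  exact InvestmentGame.commonlyLearn_outcomeMeasure σ hp₀ hp₁ hf θ
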